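/- Let $\mathcal G=(\mathcal V,\mathcal E)$ be a finite undirected simple graph, let $\mathcal N_i$ be the set of neighbours of node $i$, and for each $i\in\mathcal V$ let $f_i\big(x_i,\{x_j\}_{j\in\mathcal N_i}\big)$, with all $x_j\in\mathbb R^n$, be a closed, proper, convex function with values in $\mathbb R\cup\{+\infty\}$ (not identically $+\infty$). Consider the problem $$\min_{x_i\in\mathbb R^n,\ i\in\mathcal V}\ \sum_{i\in\mathcal V} f_i\big(x_i,\{x_j\}_{j\in\mathcal N_i}\big).\qquad(1)$$ Node $i$ keeps a copy $x_i^{(i)}$ of its own variable and copies $x_j^{(i)}$ of the variables of its neighbours, $\mathbf x^{(i)}=(x_i^{(i)},\{x_j^{(i)}\}_{j\in\mathcal N_i})$, so that (1) is equivalent to minimizing $\sum_i f_i(\mathbf x^{(i)})+\iota(\mathbf y)$ subject to $x_i^{(i)}=y_i^{(i,j)}$ and $x_j^{(i)}=y_j^{(i,j)}$ for all $i\in\mathcal V$, $j\in\mathcal N_i$, where $\iota(\mathbf y)=0$ if $y_i^{(i,j)}=y_i^{(j,i)}$ for all $i\in\mathcal V$, $j\in\mathcal N_i$, and $\iota(\mathbf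 y)=+\infty$ otherwise. Assume that this problem has a primal-dual solution, i.e. that its (non-augmented) Lagrangian $$\mathcal L(\mathbf x,\mathbf y;\mathbf w)=\sum_{i} f_i(\mathbf x^{(i)})+\iota(\mathbf y)+\sum_{i}\sum_{j\in\mathcal N_i}\Big((w_i^{(i,j)})^\top\big(x_i^{(i)}-y_i^{(i,j)}\big)+(w_j^{(i,j)})^\top\big(x_j^{(i)}-y_j^{(i,j)}\big)\Big)$$ has a saddle point; in particular (1) has an optimal solution. Assume moreover that $f_i$ has at most one minimizer whenever the node $i$ has no neighbours. Let $0<\alpha<1$ and $\rho>0$. For each ordered pair of neighbours $(j,i)$ let $z_i^{(j,i)},z_j^{(j,i)}\in\mathbb R^n$ be auxiliary variables, with arbitrary (deterministic) values at time $k=0$. The robust partition-based R-ADMM iterates the following steps for $k=0,1,2,\dots$. Each node $i$ computes $$\mathbf x^{(i)}(k)=\operatorname*{arg\,min}_{x_i^{(i)},\{x_j^{(i)}\}_{j\in\mathcal N_i}}\Big\{f_i\big(x_i^{(i)},\{x_j^{(i)}\}_{j\in\mathcal N_i}\big)-\Big(\sum_{j\in\mathcal N_i}z_i^{(j,i)}(k)\Big)^{\!\top}x_i^{(i)}-\sum_{j\in\mathcal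 N_i}z_j^{(j,i)}(k)^\top x_j^{(i)}+\frac\rho2|\mathcal N_i|\|x_i^{(i)}\|^2+\frac\rho2\sum_{j\in\mathcal N_i}\|x_j^{(i)}\|^2\Big\}$$ and sends to each neighbour $j$ the packet consisting of $q_i^{(i\to j)}=-z_i^{(j,i)}(k)+2\rho x_i^{(i)}(k)$ and $q_j^{(i\to j)}=-z_j^{(j,i)}(k)+2\rho x_j^{(i)}(k)$. Let $L^{(i\to j)}(k)\in\{0,1\}$ equal $1$ if this packet is lost and $0$ otherwise; the random variables $L^{(i\to j)}(k)$, over all ordered pairs of neighbours $(i,j)$ and all $k$, are independent, and each equals $1$ with the same probability $p\in[0,1)$. If $L^{(j\to i)}(k)=0$, node $i$ sets $z_m^{(j,i)}(k+1)=(1-\alpha)z_m^{(j,i)}(k)+\alpha q_m^{(j\to i)}$ for $m\in\{i,j\}$; if $L^{(j\to i)}(k)=1$, it sets $z_m^{(j,i)}(k+1)=z_m^{(j,i)}(k)$ for $m\in\{i,j\}$. Then every $\arg\min$ above exists and is unique and, for any initial condition, with probability one there is an optimal solution $\mathbf x^*=(x_i^*)_{i\in\mathcal V}$ of (1) such that $$\lim_{k\to\infty}x_i^{(i)}(k)=x_i^*,\qquad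 \lim_{k\to\infty}x_j^{(i)}(k)=x_j^*,\qquad\forall\, i\in\mathcal V,\ j\in\mathcal N_i.$$ If (1) has only one optimal solution, $\mathbf x^*$ is that solution; otherwise $\mathbf x^*$ may depend on the realization of the losses. -/

import Mathlib

open Filter Topology MeasureTheory ProbabilityTheory

namespace PartitionADMM

/-- The space `ℝⁿ` of a single node state, with its Euclidean norm. -/
abbrev State (n : ℕ) : Type := EuclideanSpace ℝ (Fin n)

variable {V : Type*}

/-- The variables stored by node `i`: the pair `(x_i^{(i)}, {x_j^{(i)}}_{j ∈ N_i})`. -/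
abbrev LocalVar (G : SimpleGraph V) (n : ℕ) (i : V) : Type _ :=
  State n × (G.neighborSet i → State n)

/-- Vectors with two blocks per directed edge. For the dart `d = (i, j)`, the blocks of `z` are
`(z d).1 = z_i^{(i,j)}` and `(z d).2 = z_j^{(i,j)}`. -/
abbrev EdgeVar (G : SimpleGraph V) (n : ℕ) : Type _ := G.Dart → State n × State n

/-- The directed edge `(j, i)` from a neighbour `j` of `i` into `i`. -/
def inDart (G : SimpleGraph V) (i : V) (j : G.neighborSet i) : G.Dart :=
  ⟨((j : V), i), SimpleGraph.Adj.symm j.2⟩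

/-- An extended-real-valued function is closed, proper and convex: it never takes the value `-∞`,
it is not identically `+∞`, it is lower semicontinuous, and its epigraph is convex. -/
structure IsClosedProperConvex {X : Type*} [AddCommGroup X] [Module ℝ X] [TopologicalSpace X]
    (f : X → EReal) : Prop where
  ne_bot : ∀ x, f x ≠ ⊥
  exists_ne_top : ∃ x, f x ≠ ⊤
  closed : LowerSemicontinuous f
  convex : Convex ℝ {q : X × ℝ | f q.1 ≤ (q.2 : EReal)}

section Problem

variable {G : SimpleGraph V} {n : ℕ}

/-- The cost `∑ i, f_i (x_i, {x_j}_{j ∈ N_i})` of a global state `x`. -/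
noncomputable def totalCost [Fintype V] (f : (i : V) → LocalVar G n i → EReal)
    (x : V → State n) : EReal :=
  ∑ i, f i (x i, fun j => x j)

/-- `x` is an optimal solution of the partition-based problem: it has finite cost and
minimizes the cost. -/
def IsOptimal [Fintype V] (f : (i : V) → LocalVar G n i → EReal) (x : V → State n) : Prop :=
  totalCost f x ≠ ⊤ ∧ ∀ x' : V → State n, totalCost f x ≤ totalCost f x'

/-- The permutation `P` that swaps `y_i^{(i,j)}` with `y_i^{(j,i)}`. -/
def swapP (y : EdgeVar G n) : EdgeVar G n := fun d => (y d.symm).swap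

/-- The linear map `A` for which `A x + y = 0` says that the bridge variables are copies of the
local variables: `x_i^{(i)} = y_i^{(i,j)}` and `x_j^{(i)} = y_j^{(i,j)}`. -/
def bridgeA (x : (i : V) → LocalVar G n i) : EdgeVar G n :=
  fun d => (-(x d.fst).1, -(x d.fst).2 ⟨d.snd, d.adj⟩)

open Classical in
/-- The indicator function of the bridge constraint `y = P y`. -/
noncomputable def bridgeIndicator (y : EdgeVar G n) : EReal := if swapP y = y then 0 else ⊤

/-- The Lagrangian `∑ i, f_i (x^{(i)}) + ι(y) - wᵀ (A x + y)` of the problem of minimizing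
`∑ i, f_i (x^{(i)}) + ι(y)` subject to `A x + y = 0`. -/
noncomputable def lagrangian [Fintype V] [DecidableRel G.Adj]
    (f : (i : V) → LocalVar G n i → EReal)
    (x : (i : V) → LocalVar G n i) (y w : EdgeVar G n) : EReal :=
  (∑ i, f i (x i)) + bridgeIndicator y +
    ((-∑ d : G.Dart, (inner ℝ (w d).1 (bridgeA x d + y d).1 +
      inner ℝ (w d).2 (bridgeA x d + y d).2) : ℝ) : EReal)

/-- `(x, y; w)` is a saddle point of the Lagrangian, that is, a primal-dual solution. -/
def IsSaddlePoint [Fintype V] [DecidableRel G.Adj] (f : (i : V) → LocalVar G n i → EReal)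
    (x : (i : V) → LocalVar G n i) (y w : EdgeVar G n) : Prop :=
  (∀ w', lagrangian f x y w' ≤ lagrangian f x y w) ∧
    ∀ x' y', lagrangian f x y w ≤ lagrangian f x' y' w

end Problem

section Algorithm

variable {G : SimpleGraph V} {n : ℕ}

/-- The function minimized by node `i` when it updates its local variables
`v = (x_i^{(i)}, {x_j^{(i)}}_{j ∈ N_i})`. -/
noncomputable def updateObjective [Fintype V] [DecidableRel G.Adj]
    (f : (i : V) → LocalVar G n i → EReal)
    (ρ : ℝ) (z : EdgeVar G n) (i : V) (v : LocalVar G n i) : EReal :=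
  f i v +
    ((-inner ℝ (∑ j, (z (inDart G i j)).2) v.1 - ∑ j, inner ℝ (z (inDart G i j)).1 (v.2 j)
      + ρ / 2 * (G.degree i : ℝ) * ‖v.1‖ ^ 2 + ρ / 2 * ∑ j, ‖v.2 j‖ ^ 2 : ℝ) : EReal)

/-- `v` belongs to the `argmin` of the local update of node `i`. -/
def IsLocalUpdate [Fintype V] [DecidableRel G.Adj] (f : (i : V) → LocalVar G n i → EReal)
    (ρ : ℝ) (z : EdgeVar G n) (i : V) (v : LocalVar G n i) : Prop :=
  ∀ u : LocalVar G n i, updateObjective f ρ z i v ≤ updateObjective f ρ z i u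

/-- The packet `(q_i^{(i → j)}, q_j^{(i → j)})` sent along the directed edge `d = (i, j)`:
`q_i^{(i → j)} = -z_i^{(j,i)} + 2ρ x_i^{(i)}` and `q_j^{(i → j)} = -z_j^{(j,i)} + 2ρ x_j^{(i)}`. -/
noncomputable def packet (ρ : ℝ) (z : EdgeVar G n) (x : (i : V) → LocalVar G n i) (d : G.Dart) :
    State n × State n :=
  (-(z d.symm).2 + (2 * ρ) • (x d.fst).1,
    -(z d.symm).1 + (2 * ρ) • (x d.fst).2 ⟨d.snd, d.adj⟩)

/-- `(x, z)` is a trajectory of the robust partition-based R-ADMM with initial auxiliary variables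
`z₀`, where `lost k d = true` says that the packet sent along the directed edge `d` during
iteration `k` is lost. -/
structure IsTrajectory [Fintype V] [DecidableRel G.Adj] (f : (i : V) → LocalVar G n i → EReal)
    (α ρ : ℝ) (lost : ℕ → G.Dart → Bool) (z₀ : EdgeVar G n)
    (x : ℕ → (i : V) → LocalVar G n i) (z : ℕ → EdgeVar G n) : Prop where
  init : z 0 = z₀
  local_update : ∀ k i, IsLocalUpdate f ρ (z k) i (x k i)
  edge_update : ∀ k d, z (k + 1) d =
    if lost k d = true then z k d else (1 - α) • z k d + α • packet ρ (z k) (x k) d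

end Algorithm

end PartitionADMM

namespace PartitionADMM

/-! ### Convergence of nonnegative supermartingales and conditioning on an independent event. -/

section Supermartingale

variable {Ω : Type*} {m0 : MeasurableSpace Ω} {μ : Measure Ω}

/-! Write `P` for `swapMap`, `C` for `allCopies` and `x(z)` for the local minimizers. The packets
form the vector `T z = -P z + 2ρ C x(z)`, and the algorithm relaxes `z` towards `T z` on exactly
those blocks whose packet arrives. It is thus a randomized Krasnoselskii-Mann iteration on the edge
variables.

The operator: node `i` minimizes `f_i` plus a quadratic in its copies, so with `c = C x(z) - C
x(z')` and `s = P (z - z')` monotonicity of subgradients gives `ρ‖c‖² ≤ ⟪s, c⟫`. Expanding `‖2ρ c -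
s‖²` then shows that `T` is nonexpansive (`norm_packet_sub_le`). At a fixed point `2ρ C x = z + P
z`: the copies agree, and the subgradients `P z - ρ C x` change sign under `P`, hence are orthogonal
to all consistent directions, which gives optimality (`isOptimal_of_packet_eq`). Conversely, a
saddle point with multiplier `w` yields the fixed point `ρ C x + w`
(`IsSaddlePoint.exists_packet_eq`).

The randomness: given the past, every block moves with the same probability `1 - p`, so the expected
squared distance to any fixed point drops by at least `(1 - p) α (1 - α) ‖T z - z‖²`.
Supermartingale convergence makes the residual vanish and the distances to countably many fixed
points converge, almost surely; Opial's argument gives a limit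
(`ae_tendsto_fixedPoint_of_lossyIteration`). Since `C x(z)` is Lipschitz in `z`, the local variables
converge too. -/

theorem Supermartingale.exists_ae_tendsto_of_nonneg [IsProbabilityMeasure μ] {ℱ : Filtration ℕ m0}
    {f : ℕ → Ω → ℝ} (hf : Supermartingale f ℱ μ) (h0 : ∀ k ω, 0 ≤ f k ω) :
    ∀ᵐ ω ∂μ, ∃ c, Tendsto (fun k => f k ω) atTop (𝓝 c) := by
  -- Nonnegativity turns the `L¹` norm into the expectation, which is at most the initial one.
  have hb : ∀ k, eLpNorm ((-f) k) 1 μ ≤ (Real.toNNReal (∫ ω, f 0 ω ∂μ) : ENNReal) := by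
    intro k
    rw [Pi.neg_apply, eLpNorm_neg, eLpNorm_one_eq_lintegral_enorm,
      ← ofReal_integral_norm_eq_lintegral_enorm (hf.integrable k)]
    refine ENNReal.ofReal_le_ofReal ?_
    have h := hf.setIntegral_le (Nat.zero_le k) (s := Set.univ) MeasurableSet.univ
    simp only [Measure.restrict_univ] at h
    refine le_trans (le_of_eq ?_) h
    exact integral_congr_ae (.of_forall fun ω => by simp [abs_of_nonneg (h0 k ω)])
  filter_upwards [hf.neg.exists_ae_tendsto_of_bdd hb] with ω ⟨c, hc⟩
  exact ⟨-c, by simpa using hc.neg⟩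

/-- The integrand is `I * (A - B) + B` with `I` the indicator of the event: `A` and `B` are known
given `m`, and `I` averages to its probability. -/
theorem condExp_ite_of_indep {m m' m0 : MeasurableSpace Ω} {μ : Measure Ω}
    [IsProbabilityMeasure μ] (hm : m ≤ m0) (hm' : m' ≤ m0) (hind : Indep m' m μ) {s : Ω → Prop} [DecidablePred s]
    (hs : MeasurableSet[m'] {ω | s ω}) {A B : Ω → ℝ} (hA : StronglyMeasurable[m] A)
    (hB : StronglyMeasurable[m] B) (hAi : Integrable A μ) (hBi : Integrable B μ) :
    μ[fun ω => if s ω then A ω else B ω | m] =ᵐ[μ]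
      fun ω => μ.real {ω | s ω} * A ω + (1 - μ.real {ω | s ω}) * B ω := by
  set I : Ω → ℝ := Set.indicator {ω | s ω} 1 with hI
  have hs0 : MeasurableSet {ω | s ω} := hm' _ hs
  have hIi : Integrable I μ := (integrable_const (1 : ℝ)).indicator hs0
  have hIE : μ[I | m] =ᵐ[μ] fun _ => μ.real {ω | s ω} := by
    have h := condExp_indep_eq hm' hm (f := I) (stronglyMeasurable_one.indicator hs) hind
    rwa [hI, integral_indicator_one hs0] at h
  have hIm : AEStronglyMeasurable I μ := hIi.1
  have hprod : Integrable (I * (A - B)) μ := by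
    refine (hAi.sub hBi).mono (hIm.mul (hAi.sub hBi).1) (.of_forall fun ω => ?_)
    by_cases h : s ω <;> simp [hI, Set.indicator, h]
  have hdec : (fun ω => if s ω then A ω else B ω) = I * (A - B) + B := by
    funext ω
    by_cases h : s ω <;> simp [hI, Set.indicator, h]
  rw [hdec]
  filter_upwards [condExp_add hprod hBi m,
    condExp_mul_of_stronglyMeasurable_right (hA.sub hB) hprod hIi, hIE] with ω h1 h2 h3
  rw [h1, Pi.add_apply, h2, Pi.mul_apply, h3, condExp_of_stronglyMeasurable hm hB hBi, Pi.sub_apply]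
  ring

/-- The `σ`-algebra generated by the variables `L j i` with `j < k`. -/
def pastFiltration {ι β : Type*} [MeasurableSpace β] (L : ℕ → ι → Ω → β)
    (hL : ∀ k i, Measurable (L k i)) : Filtration ℕ m0 where
  seq k := ⨆ q ∈ {q : ℕ × ι | q.1 < k}, MeasurableSpace.comap (L q.1 q.2) inferInstance
  mono' _ _ h := biSup_mono fun _ hq => lt_of_lt_of_le hq h
  le' _ := iSup₂_le fun q _ => (hL q.1 q.2).comap_le

theorem indep_pastFiltration {ι β : Type*} [MeasurableSpace β] {L : ℕ → ι → Ω → β}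
    (hL : ∀ k i, Measurable (L k i)) (hind : iIndepFun (fun q : ℕ × ι => L q.1 q.2) μ)
    (k : ℕ) (i : ι) :
    Indep (MeasurableSpace.comap (L k i) inferInstance) (pastFiltration L hL k) μ := by
  have h := indep_iSup_of_disjoint (fun q : ℕ × ι => (hL q.1 q.2).comap_le)
    ((iIndepFun_iff_iIndep _ _ _).1 hind)
    (S := {(k, i)}) (T := {q : ℕ × ι | q.1 < k}) (by simp)
  rw [iSup_singleton] at h
  exact h

theorem measurable_pastFiltration {ι β : Type*} [MeasurableSpace β] {L : ℕ → ι → Ω → β}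
    (hL : ∀ k i, Measurable (L k i)) {j k : ℕ} (hjk : j < k) (i : ι) :
    Measurable[pastFiltration L hL k] (L j i) :=
  Measurable.of_comap_le <| le_iSup₂_of_le
    (f := fun (q : ℕ × ι) (_ : q ∈ {q : ℕ × ι | q.1 < k}) =>
      MeasurableSpace.comap (L q.1 q.2) inferInstance) (j, i) hjk le_rfl

end Supermartingale

/-! ### Krasnoselskii-Mann iterations with random block losses. -/

section KrasnoselskiiMann

variable {ι : Type*} [Fintype ι] {H : Type*} [NormedAddCommGroup H] [InnerProductSpace ℝ H]

theorem norm_sq_convexComb {E : Type*} [NormedAddCommGroup E] [InnerProductSpace ℝ E] (α : ℝ)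
    (a b : E) : ‖(1 - α) • a + α • b‖ ^ 2 =
      (1 - α) * ‖a‖ ^ 2 + α * ‖b‖ ^ 2 - α * (1 - α) * ‖b - a‖ ^ 2 := by
  rw [norm_add_sq_real, norm_sub_sq_real, norm_smul, norm_smul, inner_smul_left, inner_smul_right,
    mul_pow, mul_pow, Real.norm_eq_abs, Real.norm_eq_abs, sq_abs, sq_abs, real_inner_comm b a]
  simp only [conj_trivial]
  ring

variable {Ω : Type*} {m0 : MeasurableSpace Ω} {μ : Measure Ω}

/-- Asynchronous Krasnoselskii-Mann iterates: at time `k` block `i` is left unchanged when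
`L k i` holds and is relaxed towards `T` otherwise. -/
def IsLossyIteration (T : PiLp 2 (fun _ : ι => H) → PiLp 2 (fun _ : ι => H)) (α : ℝ)
    (lost : ℕ → ι → Bool) (z : ℕ → PiLp 2 (fun _ : ι => H)) : Prop :=
  ∀ k i, z (k + 1) i = if lost k i = true then z k i else (1 - α) • z k i + α • T (z k) i

section Pathwise

variable {T : PiLp 2 (fun _ : ι => H) → PiLp 2 (fun _ : ι => H)} {α : ℝ} {lost : ℕ → ι → Bool}
  {z : ℕ → PiLp 2 (fun _ : ι => H)} {a : PiLp 2 (fun _ : ι => H)}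

theorem IsLossyIteration.norm_sq_sub (hz : IsLossyIteration T α lost z) (k : ℕ) :
    ‖z (k + 1) - a‖ ^ 2 = ∑ i, if lost k i = true then ‖(z k - a) i‖ ^ 2
      else ‖((1 - α) • (z k - a) + α • (T (z k) - a)) i‖ ^ 2 := by
  rw [PiLp.norm_sq_eq_of_L2]
  refine Finset.sum_congr rfl fun i _ => ?_
  rw [PiLp.sub_apply, hz k i]
  split_ifs with h
  · rfl
  · congr 2
    simp only [PiLp.add_apply, PiLp.smul_apply, PiLp.sub_apply]
    module

theorem norm_sq_relaxation_le (hα0 : 0 < α) (hT : ∀ a b, ‖T a - T b‖ ≤ ‖a - b‖) (ha : T a = a)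
    (y : PiLp 2 (fun _ : ι => H)) :
    ‖(1 - α) • (y - a) + α • (T y - a)‖ ^ 2 ≤ ‖y - a‖ ^ 2 - α * (1 - α) * ‖T y - y‖ ^ 2 := by
  rw [norm_sq_convexComb, sub_sub_sub_cancel_right]
  have h : ‖T y - a‖ ^ 2 ≤ ‖y - a‖ ^ 2 := by
    have := hT y a
    rw [ha] at this
    gcongr
  nlinarith

/-- A crude pathwise bound that serves only integrability: each block contributes its old or its
relaxed term, and keeping both at most doubles the total. -/
theorem IsLossyIteration.norm_sq_sub_le (hz : IsLossyIteration T α lost z) (hα0 : 0 < α)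
    (hα1 : α < 1) (hT : ∀ a b, ‖T a - T b‖ ≤ ‖a - b‖) (ha : T a = a) (k : ℕ) :
    ‖z k - a‖ ^ 2 ≤ 2 ^ k * ‖z 0 - a‖ ^ 2 := by
  induction k with
  | zero => simp
  | succ k ih =>
    have h1 : ‖z (k + 1) - a‖ ^ 2 ≤
        ‖z k - a‖ ^ 2 + ‖(1 - α) • (z k - a) + α • (T (z k) - a)‖ ^ 2 := by
      rw [hz.norm_sq_sub, PiLp.norm_sq_eq_of_L2 _ (z k - a),
        PiLp.norm_sq_eq_of_L2 _ ((1 - α) • (z k - a) + α • (T (z k) - a)),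
        ← Finset.sum_add_distrib]
      refine Finset.sum_le_sum fun i _ => ?_
      split_ifs
      · exact le_add_of_nonneg_right (sq_nonneg _)
      · exact le_add_of_nonneg_left (sq_nonneg _)
    have h2 := norm_sq_relaxation_le hα0 hT ha (z k)
    have h3 : 0 ≤ α * (1 - α) * ‖T (z k) - z k‖ ^ 2 :=
      mul_nonneg (mul_nonneg hα0.le (by linarith)) (sq_nonneg _)
    rw [pow_succ (2 : ℝ)]
    linarith

end Pathwise

/-- Opial's argument: convergence of the distances to a dense set of fixed points and vanishing
residuals imply convergence to a fixed point. -/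
theorem exists_tendsto_fixedPoint {E : Type*} [NormedAddCommGroup E] [ProperSpace E] {T : E → E}
    (hT : Continuous T) {C : Set E} (hdense : ∀ a, T a = a → a ∈ closure C)
    (hne : C.Nonempty) {z : ℕ → E}
    (hdist : ∀ a ∈ C, ∃ c, Tendsto (fun k => ‖z k - a‖) atTop (𝓝 c))
    (hres : Tendsto (fun k => T (z k) - z k) atTop (𝓝 0)) :
    ∃ a, T a = a ∧ Tendsto z atTop (𝓝 a) := by
  obtain ⟨a₀, ha₀⟩ := hne
  obtain ⟨c₀, hc₀⟩ := hdist a₀ ha₀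
  obtain ⟨R, hR⟩ := hc₀.bddAbove_range
  have hmem : ∀ k, z k ∈ Metric.closedBall a₀ R := fun k => by
    rw [mem_closedBall_iff_norm]
    exact hR ⟨k, rfl⟩
  obtain ⟨a, -, φ, hφ, ha⟩ := (isCompact_closedBall a₀ R).tendsto_subseq hmem
  have hfix : T a = a := by
    have h1 := hres.comp hφ.tendsto_atTop
    have h2 := ((hT.tendsto a).comp ha).sub ha
    exact sub_eq_zero.1 (tendsto_nhds_unique h2 h1)
  refine ⟨a, hfix, Metric.tendsto_atTop.2 fun ε hε => ?_⟩
  -- The cluster point `a` need not lie in `C`, so its distance is controlled through a nearby `b ∈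
  -- C`.
  obtain ⟨b, hb, hab⟩ := Metric.mem_closure_iff.1 (hdense a hfix) (ε / 2) (by linarith)
  obtain ⟨c, hc⟩ := hdist b hb
  have hcab : c = ‖a - b‖ :=
    tendsto_nhds_unique (hc.comp hφ.tendsto_atTop) ((ha.sub_const b).norm)
  have hlt : c < ε / 2 := by rwa [hcab, ← dist_eq_norm]
  obtain ⟨N, hN⟩ := eventually_atTop.1 (hc.eventually_lt_const hlt)
  refine ⟨N, fun k hk => ?_⟩
  have := dist_triangle (z k) b a
  have h1 := hN k hk
  rw [← dist_eq_norm] at h1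
  rw [dist_comm b a] at this
  linarith

/-- The state at time `k` depends only on losses strictly before `k`; this is what makes the losses
at time `k` independent of it. -/
theorem stronglyMeasurable_lossyIteration [FiniteDimensional ℝ H]
    {T : PiLp 2 (fun _ : ι => H) → PiLp 2 (fun _ : ι => H)} (hT : Continuous T) {α : ℝ}
    {L : ℕ → ι → Ω → Bool} (hL : ∀ k i, Measurable (L k i)) {z₀ : PiLp 2 (fun _ : ι => H)}
    {z : Ω → ℕ → PiLp 2 (fun _ : ι => H)} (h0 : ∀ ω, z ω 0 = z₀)
    (hz : ∀ ω, IsLossyIteration T α (fun k i => L k i ω) (z ω)) (k : ℕ) :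
    StronglyMeasurable[pastFiltration L hL k] (fun ω => z ω k) := by
  borelize H
  have : ProperSpace H := FiniteDimensional.proper ℝ H
  induction k with
  | zero =>
    simp only [h0]
    exact stronglyMeasurable_const
  | succ k ih =>
    have hz1 : StronglyMeasurable[pastFiltration L hL (k + 1)] (fun ω => z ω k) :=
      ih.mono ((pastFiltration L hL).mono k.le_succ)
    have hm : Measurable[pastFiltration L hL (k + 1)] (fun ω i => z ω (k + 1) i) := by
      refine @measurable_pi_lambda _ _ _ (pastFiltration L hL (k + 1)) _ _ fun i => ?_
      simp only [fun ω => hz ω k i]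
      have hc : Continuous fun y : PiLp 2 (fun _ : ι => H) => y i := by fun_prop
      refine StronglyMeasurable.measurable (StronglyMeasurable.ite
        (measurable_pastFiltration hL k.lt_succ_self i (measurableSet_singleton true))
        (hc.comp_stronglyMeasurable hz1) ?_)
      have hc' : Continuous fun y : PiLp 2 (fun _ : ι => H) => (1 - α) • y i + α • T y i :=
        (hc.const_smul _).add ((hc.comp hT).const_smul _)
      exact hc'.comp_stronglyMeasurable hz1
    exact (PiLp.continuous_toLp 2 (fun _ : ι => H)).comp_stronglyMeasurable hm.stronglyMeasurable

/-- The stochastic Krasnoselskii-Mann theorem for independent losses of equal probability. -/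
theorem ae_tendsto_fixedPoint_of_lossyIteration [FiniteDimensional ℝ H] [IsProbabilityMeasure μ]
    {T : PiLp 2 (fun _ : ι => H) → PiLp 2 (fun _ : ι => H)}
    (hT : ∀ a b, ‖T a - T b‖ ≤ ‖a - b‖) (hfix : ∃ a, T a = a) {α p : ℝ} (hα0 : 0 < α)
    (hα1 : α < 1) (hp0 : 0 ≤ p) (hp1 : p < 1) {L : ℕ → ι → Ω → Bool}
    (hL : ∀ k i, Measurable (L k i)) (hind : iIndepFun (fun q : ℕ × ι => L q.1 q.2) μ)
    (hprob : ∀ k i, μ {ω | L k i ω = true} = ENNReal.ofReal p) {z₀ : PiLp 2 (fun _ : ι => H)}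
    {z : Ω → ℕ → PiLp 2 (fun _ : ι => H)} (h0 : ∀ ω, z ω 0 = z₀)
    (hz : ∀ ω, IsLossyIteration T α (fun k i => L k i ω) (z ω)) :
    ∀ᵐ ω ∂μ, ∃ a, T a = a ∧ Tendsto (z ω) atTop (𝓝 a) := by
  have : ProperSpace (PiLp 2 (fun _ : ι => H)) := FiniteDimensional.proper ℝ _
  have hTc : Continuous T := (LipschitzWith.of_dist_le_mul (K := 1) fun a b => by
    simpa [dist_eq_norm] using hT a b).continuous
  set ℱ := pastFiltration L hL with hℱ
  have hm := stronglyMeasurable_lossyIteration hTc hL h0 hz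
  set c : ℝ := (1 - p) * (α * (1 - α)) with hc
  have hcpos : 0 < c := mul_pos (by linarith) (mul_pos hα0 (by linarith))
  set r : ℕ → Ω → ℝ := fun k ω => ‖T (z ω k) - z ω k‖ ^ 2 with hr
  have hrm : ∀ k, StronglyMeasurable[ℱ k] (r k) := fun k =>
    (show Continuous fun y => ‖T y - y‖ ^ 2 by fun_prop).comp_stronglyMeasurable (hm k)
  obtain ⟨a₀, ha₀⟩ := hfix
  have hr0 : ∀ k ω, 0 ≤ r k ω := fun k ω => sq_nonneg _
  have hint : ∀ (g : Ω → ℝ) (C : ℝ) (k : ℕ), StronglyMeasurable[ℱ k] g →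
      (∀ ω, 0 ≤ g ω) → (∀ ω, g ω ≤ C) → Integrable g μ := fun g C k hg hg0 hgC =>
    Integrable.of_bound ((hg.mono (ℱ.le k)).aestronglyMeasurable) C
      (.of_forall fun ω => by rw [Real.norm_eq_abs, abs_of_nonneg (hg0 ω)]; exact hgC ω)
  have hVb : ∀ a, T a = a → ∀ k ω, ‖z ω k - a‖ ^ 2 ≤ 2 ^ k * ‖z₀ - a‖ ^ 2 := fun a ha k ω => by
    simpa only [h0] using (hz ω).norm_sq_sub_le hα0 hα1 hT ha k
  have hVm : ∀ a k, StronglyMeasurable[ℱ k] (fun ω => ‖z ω k - a‖ ^ 2) := fun a k =>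
    (show Continuous fun y => ‖y - a‖ ^ 2 by fun_prop).comp_stronglyMeasurable (hm k)
  have hVi : ∀ a, T a = a → ∀ k, Integrable (fun ω => ‖z ω k - a‖ ^ 2) μ := fun a ha k =>
    hint _ _ k (hVm a k) (fun _ => sq_nonneg _) (hVb a ha k)
  have hrel : ∀ a, T a = a → ∀ y, ‖(1 - α) • (y - a) + α • (T y - a)‖ ^ 2 ≤
      ‖y - a‖ ^ 2 - α * (1 - α) * ‖T y - y‖ ^ 2 := fun a ha y => norm_sq_relaxation_le hα0 hT ha y
  have hri : ∀ k, Integrable (r k) μ := fun k => by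
    refine hint _ (2 ^ k * ‖z₀ - a₀‖ ^ 2 / (α * (1 - α))) k (hrm k) (hr0 k) fun ω => ?_
    have hpos : 0 < α * (1 - α) := mul_pos hα0 (by linarith)
    rw [le_div_iff₀ hpos]
    have h1 := hrel a₀ ha₀ (z ω k)
    have h2 := hVb a₀ ha₀ k ω
    have h3 := sq_nonneg ‖(1 - α) • (z ω k - a₀) + α • (T (z ω k) - a₀)‖
    simp only [hr]
    linarith
  have hstep : ∀ a, T a = a → ∀ k, μ[fun ω => ‖z ω (k + 1) - a‖ ^ 2 | ℱ k] ≤ᵐ[μ]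
      fun ω => ‖z ω k - a‖ ^ 2 - c * r k ω := by
    intro a ha k
    set A : ι → Ω → ℝ := fun i ω => ‖(z ω k - a) i‖ ^ 2 with hA
    set B : ι → Ω → ℝ := fun i ω => ‖((1 - α) • (z ω k - a) + α • (T (z ω k) - a)) i‖ ^ 2 with hB
    have hAm : ∀ i, StronglyMeasurable[ℱ k] (A i) := fun i =>
      (show Continuous fun y : PiLp 2 (fun _ : ι => H) => ‖(y - a) i‖ ^ 2 by
        fun_prop).comp_stronglyMeasurable (hm k)
    have hBm : ∀ i, StronglyMeasurable[ℱ k] (B i) := fun i =>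
      (show Continuous fun y : PiLp 2 (fun _ : ι => H) =>
        ‖((1 - α) • (y - a) + α • (T y - a)) i‖ ^ 2 by
        fun_prop).comp_stronglyMeasurable (hm k)
    have hblock : ∀ (y : PiLp 2 (fun _ : ι => H)) (i : ι), ‖y i‖ ^ 2 ≤ ‖y‖ ^ 2 := fun y i => by
      have := PiLp.norm_apply_le y i
      gcongr
    have hAi : ∀ i, Integrable (A i) μ := fun i =>
      hint _ _ k (hAm i) (fun _ => sq_nonneg _) fun ω => (hblock _ i).trans (hVb a ha k ω)
    have hBi : ∀ i, Integrable (B i) μ := fun i =>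
      hint _ _ k (hBm i) (fun _ => sq_nonneg _) fun ω => (hblock _ i).trans <|
        ((hrel a ha _).trans <| sub_le_self _ <| mul_nonneg
          (mul_nonneg hα0.le (by linarith)) (sq_nonneg _)).trans (hVb a ha k ω)
    have hexp : (fun ω => ‖z ω (k + 1) - a‖ ^ 2) =
        ∑ i, fun ω => if L k i ω = true then A i ω else B i ω := by
      funext ω
      rw [Finset.sum_apply, (hz ω).norm_sq_sub]
    have hcond : ∀ i, μ[fun ω => if L k i ω = true then A i ω else B i ω | ℱ k] =ᵐ[μ]
        fun ω => p * A i ω + (1 - p) * B i ω := fun i => by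
      have h := condExp_ite_of_indep (ℱ.le k) (hL k i).comap_le
        (indep_pastFiltration hL hind k i) (s := fun ω => L k i ω = true)
        ⟨{true}, measurableSet_singleton _, rfl⟩ (hAm i) (hBm i) (hAi i) (hBi i)
      rwa [measureReal_def, hprob, ENNReal.toReal_ofReal hp0] at h
    rw [hexp]
    have hsum := condExp_finsetSum (μ := μ) (s := Finset.univ)
      (f := fun i ω => if L k i ω = true then A i ω else B i ω) (fun i _ => by
        refine ((hAi i).norm.add (hBi i).norm).mono ?_ (.of_forall fun ω => ?_)
        · exact (StronglyMeasurable.ite (hL k i (measurableSet_singleton true))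
            ((hAm i).mono (ℱ.le k)) ((hBm i).mono (ℱ.le k))).aestronglyMeasurable
        · have h1 := norm_nonneg (A i ω)
          have h2 := norm_nonneg (B i ω)
          rw [Pi.add_apply, Real.norm_of_nonneg (add_nonneg h1 h2)]
          split_ifs <;> linarith) (ℱ k)
    filter_upwards [hsum, ae_all_iff.2 hcond] with ω h1 h2
    rw [h1, Finset.sum_apply, Finset.sum_congr rfl fun i _ => h2 i, Finset.sum_add_distrib,
      ← Finset.mul_sum, ← Finset.mul_sum]
    -- Because `p` is common to all blocks, the blockwise expectations reassemble into full
    -- Euclidean norms, for which `T` is nonexpansive.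
    have hAs : ∑ i, A i ω = ‖z ω k - a‖ ^ 2 := (PiLp.norm_sq_eq_of_L2 _ _).symm
    have hBs : ∑ i, B i ω = ‖(1 - α) • (z ω k - a) + α • (T (z ω k) - a)‖ ^ 2 :=
      (PiLp.norm_sq_eq_of_L2 _ _).symm
    rw [hAs, hBs]
    have h3 := mul_le_mul_of_nonneg_left (hrel a ha (z ω k)) (show 0 ≤ 1 - p by linarith)
    simp only [hr, hc]
    linarith
  have hV : ∀ a, T a = a → ∀ᵐ ω ∂μ, ∃ l, Tendsto (fun k => ‖z ω k - a‖ ^ 2) atTop (𝓝 l) := by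
    intro a ha
    refine Supermartingale.exists_ae_tendsto_of_nonneg (ℱ := ℱ)
      (f := fun k ω => ‖z ω k - a‖ ^ 2)
      (supermartingale_nat (hVm a) (hVi a ha) fun k => ?_) fun _ _ => sq_nonneg _
    filter_upwards [hstep a ha k] with ω h
    have := mul_nonneg hcpos.le (hr0 k ω)
    linarith
  -- Adding the accumulated expected decrease still leaves a nonnegative supermartingale, so the
  -- residuals are summable. The sum up to time `k` inclusive is already known at time `k`, hence
  -- the bound `k ≤ m + 1` in `hSm`.
  have hW : ∀ᵐ ω ∂μ, ∃ l, Tendsto (fun k => ‖z ω k - a₀‖ ^ 2 + ∑ j ∈ Finset.range k, c * r j ω)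
      atTop (𝓝 l) := by
    have hSm : ∀ k m, k ≤ m + 1 →
        StronglyMeasurable[ℱ m] (fun ω => ∑ j ∈ Finset.range k, c * r j ω) := fun k m hkm =>
      Finset.stronglyMeasurable_fun_sum _ fun j hj =>
        ((hrm j).mono (ℱ.mono (by have := Finset.mem_range.1 hj; omega))).const_mul c
    have hSi : ∀ k, Integrable (fun ω => ∑ j ∈ Finset.range k, c * r j ω) μ := fun k =>
      integrable_finsetSum _ fun j _ => (hri j).const_mul c
    refine Supermartingale.exists_ae_tendsto_of_nonneg (ℱ := ℱ)
      (f := fun k ω => ‖z ω k - a₀‖ ^ 2 + ∑ j ∈ Finset.range k, c * r j ω)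
      (supermartingale_nat (fun k => (hVm a₀ k).add (hSm k k k.le_succ))
        (fun k => (hVi a₀ ha₀ k).add (hSi k)) fun k => ?_)
      fun k ω => add_nonneg (sq_nonneg _)
        (Finset.sum_nonneg fun j _ => mul_nonneg hcpos.le (hr0 j ω))
    have h1 := condExp_add (hVi a₀ ha₀ (k + 1)) (hSi (k + 1)) (ℱ k)
    rw [condExp_of_stronglyMeasurable (ℱ.le k) (hSm (k + 1) k le_rfl) (hSi (k + 1))] at h1
    filter_upwards [hstep a₀ ha₀ k, h1] with ω h h1
    refine h1.trans_le ?_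
    rw [Pi.add_apply, Finset.sum_range_succ]
    linarith
  -- The exceptional null set depends on the fixed point, so only countably many may be used.
  obtain ⟨C, hCsub, hCc, hCd⟩ := TopologicalSpace.IsSeparable.exists_countable_dense_subset
    (TopologicalSpace.IsSeparable.of_separableSpace {a | T a = a})
  have hCne : C.Nonempty := by
    have : a₀ ∈ closure C := hCd ha₀
    exact closure_nonempty_iff.1 ⟨_, this⟩
  filter_upwards [(ae_ball_iff hCc).2 fun a ha => hV a (hCsub ha), hV a₀ ha₀, hW]
    with ω h1 ⟨l, hl⟩ ⟨l', hl'⟩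
  refine exists_tendsto_fixedPoint hTc (fun a ha => hCd ha) hCne (fun a ha => ?_) ?_
  · obtain ⟨l, hl⟩ := h1 a ha
    refine ⟨√l, ?_⟩
    simpa only [Real.sqrt_sq (norm_nonneg _)] using hl.sqrt
  · have hs : Tendsto (fun k => ∑ j ∈ Finset.range k, c * r j ω) atTop (𝓝 (l' - l)) := by
      simpa using hl'.sub hl
    have hs' := ((tendsto_add_atTop_iff_nat 1).2 hs).sub hs
    simp only [Finset.sum_range_succ, add_sub_cancel_left, sub_self] at hs'
    have hr' : Tendsto (fun k => r k ω) atTop (𝓝 0) := by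
      have := hs'.const_mul c⁻¹
      simpa only [inv_mul_cancel_left₀ hcpos.ne', mul_zero] using this
    rw [tendsto_zero_iff_norm_tendsto_zero]
    have := hr'.sqrt
    simpa only [hr, Real.sqrt_sq (norm_nonneg _), Real.sqrt_zero] using this

end KrasnoselskiiMann

end PartitionADMM

namespace PartitionADMM

/-! ### Existence, optimality conditions and monotonicity for proximal steps. -/

section ProximalStep

variable {X K : Type*} [NormedAddCommGroup X] [NormedSpace ℝ X]
  [NormedAddCommGroup K] [InnerProductSpace ℝ K]

/-- `Bᵀ g` is a subgradient of `f` at `v`. -/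
def HasSubgradient (f : X → EReal) (B : X →ₗ[ℝ] K) (v : X) (g : K) : Prop :=
  f v ≠ ⊤ ∧ ∀ v', f v + ((inner ℝ g (B (v' - v)) : ℝ) : EReal) ≤ f v'

/-- The smooth part of the objective of a proximal step. -/
noncomputable def proxTerm (B : X →ₗ[ℝ] K) (ρ : ℝ) (u : K) (v : X) : ℝ :=
  -inner ℝ u (B v) + ρ / 2 * ‖B v‖ ^ 2

theorem proxTerm_add (B : X →ₗ[ℝ] K) (ρ : ℝ) (u : K) (v d : X) :
    proxTerm B ρ u (v + d) =
      proxTerm B ρ u v - inner ℝ (u - ρ • B v) (B d) + ρ / 2 * ‖B d‖ ^ 2 := by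
  simp only [proxTerm, map_add, norm_add_sq_real, inner_add_right, inner_sub_left,
    real_inner_smul_left]
  ring

theorem HasSubgradient.monotone {f : X → EReal} (hbot : ∀ x, f x ≠ ⊥) {B : X →ₗ[ℝ] K} {v v' : X}
    {g g' : K} (h : HasSubgradient f B v g) (h' : HasSubgradient f B v' g') :
    0 ≤ inner ℝ (g - g') (B v - B v') := by
  have h1 := h.2 v'
  have h2 := h'.2 v
  lift f v to ℝ using ⟨h.1, hbot v⟩ with a
  lift f v' to ℝ using ⟨h'.1, hbot v'⟩ with b
  norm_cast at h1 h2
  simp only [map_sub, inner_sub_left, inner_sub_right] at *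
  linarith

/-- Move from `v` towards `v'` by a fraction `t`: convexity bounds the change of `f` linearly in
`t`, while the quadratic remainder is `t²`. Dividing by `t` and letting `t → 0` removes it. -/
theorem hasSubgradient_of_isMin {f : X → EReal} (hf : IsClosedProperConvex f) {B : X →ₗ[ℝ] K}
    {ρ : ℝ} {u : K} {v : X}
    (h : ∀ v', f v + (proxTerm B ρ u v : EReal) ≤ f v' + (proxTerm B ρ u v' : EReal)) :
    HasSubgradient f B v (u - ρ • B v) := by
  have hv : f v ≠ ⊤ := by
    intro hv
    obtain ⟨x, hx⟩ := hf.exists_ne_top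
    have := h x
    lift f x to ℝ using ⟨hx, hf.ne_bot x⟩ with b
    rw [hv, EReal.top_add_coe, top_le_iff, ← EReal.coe_add] at this
    exact EReal.coe_ne_top _ this
  refine ⟨hv, fun v' => ?_⟩
  by_cases hv' : f v' = ⊤
  · rw [hv']
    exact le_top
  obtain ⟨a, ha⟩ : ∃ a : ℝ, (a : EReal) = f v := ⟨_, EReal.coe_toReal hv (hf.ne_bot v)⟩
  obtain ⟨b, hb⟩ : ∃ b : ℝ, (b : EReal) = f v' := ⟨_, EReal.coe_toReal hv' (hf.ne_bot v')⟩
  rw [← ha, ← hb]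
  norm_cast
  set s : ℝ := inner ℝ (u - ρ • B v) (B (v' - v)) with hs
  set M : ℝ := ρ / 2 * ‖B (v' - v)‖ ^ 2 with hM
  have hineq : ∀ t : ℝ, 0 < t → t ≤ 1 → a + s - b ≤ t * M := by
    intro t ht ht1
    have hc := hf.convex (x := (v, a)) (by simp [ha]) (y := (v', b)) (by simp [hb])
      (show 0 ≤ 1 - t by linarith) ht.le (by ring)
    simp only [Set.mem_ofPred_eq, Prod.smul_mk, Prod.mk_add_mk, smul_eq_mul] at hc
    have hw : (1 - t) • v + t • v' = v + t • (v' - v) := by module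
    have hmin := (h _).trans (add_le_add_left hc _)
    rw [← ha, hw, proxTerm_add] at hmin
    norm_cast at hmin
    rw [map_smul, inner_smul_right, norm_smul, mul_pow, Real.norm_eq_abs, sq_abs, ← hs] at hmin
    have : t * (a + s - b) ≤ t * (t * M) := by
      rw [hM]
      linarith
    exact le_of_mul_le_mul_left this ht
  have hlim : Tendsto (fun t : ℝ => t * M) (𝓝[>] 0) (𝓝 0) := by
    have : Tendsto (fun t : ℝ => t * M) (𝓝 0) (𝓝 (0 * M)) := tendsto_id.mul_const M
    rw [zero_mul] at this
    exact this.mono_left nhdsWithin_le_nhds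
  have := ge_of_tendsto hlim (by
    filter_upwards [Ioc_mem_nhdsGT (show (0 : ℝ) < 1 by norm_num)] with t ht
    exact hineq t ht.1 ht.2)
  linarith

theorem HasSubgradient.isMin {f : X → EReal} (hbot : ∀ x, f x ≠ ⊥) {B : X →ₗ[ℝ] K} {ρ : ℝ}
    (hρ : 0 ≤ ρ) {u : K} {v : X} (h : HasSubgradient f B v (u - ρ • B v)) (v' : X) :
    f v + (proxTerm B ρ u v : EReal) ≤ f v' + (proxTerm B ρ u v' : EReal) := by
  by_cases hv' : f v' = ⊤
  · rw [hv', EReal.top_add_coe]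
    exact le_top
  have h1 := h.2 v'
  lift f v to ℝ using ⟨h.1, hbot v⟩ with a
  lift f v' to ℝ using ⟨hv', hbot v'⟩ with b
  have h2 := proxTerm_add B ρ u v (v' - v)
  rw [add_sub_cancel] at h2
  norm_cast at h1 ⊢
  have : 0 ≤ ρ / 2 * ‖B (v' - v)‖ ^ 2 := by positivity
  linarith

/-- Strong monotonicity of the proximal step in the image of `B`. -/
theorem mul_norm_sq_le_inner_of_isMin {f : X → EReal} (hf : IsClosedProperConvex f)
    {B : X →ₗ[ℝ] K} {ρ : ℝ} {u u' : K} {v v' : X}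
    (h : ∀ x, f v + (proxTerm B ρ u v : EReal) ≤ f x + (proxTerm B ρ u x : EReal))
    (h' : ∀ x, f v' + (proxTerm B ρ u' v' : EReal) ≤ f x + (proxTerm B ρ u' x : EReal)) :
    ρ * ‖B v - B v'‖ ^ 2 ≤ inner ℝ (u - u') (B v - B v') := by
  have := (hasSubgradient_of_isMin hf h).monotone hf.ne_bot (hasSubgradient_of_isMin hf h')
  have e : u - ρ • B v - (u' - ρ • B v') = (u - u') - ρ • (B v - B v') := by module
  rw [e, inner_sub_left, real_inner_smul_left, real_inner_self_eq_norm_sq] at this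
  linarith

theorem exists_isMin_of_hasSubgradient [FiniteDimensional ℝ X] [FiniteDimensional ℝ K]
    {f : X → EReal} (hf : IsClosedProperConvex f) {B : X →ₗ[ℝ] K} (hB : Function.Injective B)
    {ρ : ℝ} (hρ : 0 < ρ) (u : K) {x₀ : X} {g : K} (hg : HasSubgradient f B x₀ g) :
    ∃ v, ∀ x, f v + (proxTerm B ρ u v : EReal) ≤ f x + (proxTerm B ρ u x : EReal) := by
  have : ProperSpace K := FiniteDimensional.proper ℝ K
  have hBc : Continuous B := B.continuous_of_finiteDimensional
  -- By the subgradient, the objective grows from `x₀` by at least `-⟪q, B d⟫ + ρ / 2 * ‖B d‖²` with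
  -- `d = x - x₀`. This is nonnegative once `‖B d‖ ≥ R`, so minimizing over a compact set suffices.
  set q := u - ρ • B x₀ - g with hq
  set R : ℝ := 2 * ‖q‖ / ρ with hR
  have hcomp : IsCompact (B ⁻¹' Metric.closedBall (B x₀) R) :=
    (LinearMap.isClosedEmbedding_of_injective (LinearMap.ker_eq_bot.2 hB)).isCompact_preimage
      (isCompact_closedBall _ _)
  have hmem : x₀ ∈ B ⁻¹' Metric.closedBall (B x₀) R := by
    have : 0 ≤ R := by positivity
    simpa using this
  have hcont : Continuous fun x => (proxTerm B ρ u x : EReal) := by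
    refine continuous_coe_real_ereal.comp ?_
    unfold proxTerm
    fun_prop
  have hlsc : LowerSemicontinuous fun x => f x + (proxTerm B ρ u x : EReal) :=
    hf.closed.add' hcont.lowerSemicontinuous fun x =>
      EReal.continuousAt_add (.inr (EReal.coe_ne_bot _)) (.inl (hf.ne_bot x))
  obtain ⟨v, -, hv⟩ := (hlsc.lowerSemicontinuousOn _).exists_isMinOn ⟨x₀, hmem⟩ hcomp
  refine ⟨v, fun x => ?_⟩
  by_cases hx : x ∈ B ⁻¹' Metric.closedBall (B x₀) R
  · exact hv hx
  · refine (hv hmem).trans ?_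
    have hx' : R < ‖B (x - x₀)‖ := by
      simpa [dist_eq_norm] using hx
    by_cases hxt : f x = ⊤
    · rw [hxt, EReal.top_add_coe]
      exact le_top
    have h1 := hg.2 x
    have h2 := proxTerm_add B ρ u x₀ (x - x₀)
    rw [add_sub_cancel] at h2
    show f x₀ + _ ≤ _
    lift f x₀ to ℝ using ⟨hg.1, hf.ne_bot x₀⟩ with a
    lift f x to ℝ using ⟨hxt, hf.ne_bot x⟩ with b
    norm_cast at h1 ⊢
    have h3 := real_inner_le_norm q (B (x - x₀))
    have h4 : inner ℝ (u - ρ • B x₀) (B (x - x₀)) =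
        inner ℝ q (B (x - x₀)) + inner ℝ g (B (x - x₀)) := by
      rw [← inner_add_left, hq, sub_add_cancel]
    have h5 : ‖q‖ ≤ ρ / 2 * ‖B (x - x₀)‖ := by
      rw [hR, div_lt_iff₀ hρ] at hx'
      linarith
    have h6 := mul_le_mul_of_nonneg_right h5 (norm_nonneg (B (x - x₀)))
    rw [h2, h4]
    nlinarith

end ProximalStep

end PartitionADMM

namespace PartitionADMM

/-! ### Finite sums of extended reals. -/

section Extended

theorem EReal_coe_sum {ι : Type*} (s : Finset ι) (a : ι → ℝ) :
    ((∑ i ∈ s, a i : ℝ) : EReal) = ∑ i ∈ s, (a i : EReal) := by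
  classical
  induction s using Finset.induction_on with
  | empty => simp
  | insert i s hi ih => rw [Finset.sum_insert hi, Finset.sum_insert hi, EReal.coe_add, ih]

theorem EReal_sum_ne_bot {ι : Type*} {s : Finset ι} {a : ι → EReal} (h : ∀ i, a i ≠ ⊥) :
    ∑ i ∈ s, a i ≠ ⊥ := by
  classical
  induction s using Finset.induction_on with
  | empty => simp
  | insert i s hi ih =>
    rw [Finset.sum_insert hi]
    exact EReal.add_ne_bot_iff.2 ⟨h i, ih⟩

theorem EReal_ne_top_of_sum_ne_top {ι : Type*} [Fintype ι] {a : ι → EReal} (h : ∀ i, a i ≠ ⊥)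
    (hs : ∑ i, a i ≠ ⊤) (i : ι) : a i ≠ ⊤ := by
  classical
  intro hi
  apply hs
  rw [← Finset.add_sum_erase _ _ (Finset.mem_univ i), hi]
  exact EReal.top_add_of_ne_bot (EReal_sum_ne_bot h)

theorem EReal_sum_ne_top {ι : Type*} [Fintype ι] {a : ι → EReal} (h : ∀ i, a i ≠ ⊥)
    (h' : ∀ i, a i ≠ ⊤) : ∑ i, a i ≠ ⊤ := by
  rw [← Finset.sum_congr rfl fun i _ => EReal.coe_toReal (h' i) (h i), ← EReal_coe_sum]
  exact EReal.coe_ne_top _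

end Extended

/-! ### Euclidean edge space, the swap isometry and the copy maps. -/

section Spaces

variable {V : Type*} (G : SimpleGraph V) (n : ℕ)

/-- `EdgeVar` with its Euclidean structure. -/
abbrev EdgeSpace : Type _ := PiLp 2 (fun _ : G.Dart => WithLp 2 (State n × State n))

/-- The part of `EdgeSpace` that belongs to the darts leaving `i`. -/
abbrev NodeSpace (i : V) : Type _ :=
  PiLp 2 (fun _ : G.neighborSet i => WithLp 2 (State n × State n))

variable {G n}

/-- The identification of `EdgeVar` with `EdgeSpace`. -/
def toEdgeSpace (a : EdgeVar G n) : EdgeSpace G n := WithLp.toLp 2 fun d => WithLp.toLp 2 (a d)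

/-- The inverse of `toEdgeSpace`. -/
def ofEdgeSpace (a : EdgeSpace G n) : EdgeVar G n := fun d => (a d).ofLp

@[simp] theorem ofEdgeSpace_toEdgeSpace (a : EdgeVar G n) : ofEdgeSpace (toEdgeSpace a) = a := rfl

@[simp] theorem toEdgeSpace_ofEdgeSpace (a : EdgeSpace G n) : toEdgeSpace (ofEdgeSpace a) = a := rfl

@[simp] theorem toEdgeSpace_apply (a : EdgeVar G n) (d : G.Dart) :
    toEdgeSpace a d = WithLp.toLp 2 (a d) := rfl

/-- The permutation `swapP` as a linear map of `EdgeSpace`. -/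
def swapMap : EdgeSpace G n →ₗ[ℝ] EdgeSpace G n where
  toFun a := toEdgeSpace (swapP (ofEdgeSpace a))
  map_add' _ _ := rfl
  map_smul' _ _ := rfl

theorem swapMap_toEdgeSpace (a : EdgeVar G n) :
    swapMap (toEdgeSpace a) = toEdgeSpace (swapP a) := rfl

@[simp] theorem swapMap_swapMap (a : EdgeSpace G n) : swapMap (swapMap a) = a := by
  ext d : 1
  change WithLp.toLp 2 ((ofEdgeSpace a d.symm.symm).swap).swap = a d
  rw [SimpleGraph.Dart.symm_symm, Prod.swap_swap]
  rfl

/-- The restriction to the darts leaving `i`. -/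
def nodePart (i : V) : EdgeSpace G n →ₗ[ℝ] NodeSpace G n i where
  toFun a := WithLp.toLp 2 fun j => a (G.dartOfNeighborSet i j)
  map_add' _ _ := rfl
  map_smul' _ _ := rfl

/-- The copies of the local variables of node `i`, one pair for each neighbour. -/
def copies (i : V) : LocalVar G n i →ₗ[ℝ] NodeSpace G n i where
  toFun v := WithLp.toLp 2 fun j => WithLp.toLp 2 (v.1, v.2 j)
  map_add' _ _ := rfl
  map_smul' _ _ := rfl

/-- The copies of all local variables. -/
def allCopies : ((i : V) → LocalVar G n i) →ₗ[ℝ] EdgeSpace G n where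
  toFun x := WithLp.toLp 2 fun d => WithLp.toLp 2 ((x d.fst).1, (x d.fst).2 ⟨d.snd, d.adj⟩)
  map_add' _ _ := rfl
  map_smul' _ _ := rfl

@[simp] theorem nodePart_allCopies (x : (i : V) → LocalVar G n i) (i : V) :
    nodePart i (allCopies x) = copies i (x i) := rfl

theorem toEdgeSpace_bridgeA (x : (i : V) → LocalVar G n i) :
    toEdgeSpace (bridgeA x) = -allCopies x := rfl

theorem toEdgeSpace_packet (ρ : ℝ) (z : EdgeVar G n) (x : (i : V) → LocalVar G n i) :
    toEdgeSpace (packet ρ z x) = -swapMap (toEdgeSpace z) + (2 * ρ) • allCopies x := rfl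

theorem bridgeIndicator_of_eq {y : EdgeVar G n} (h : swapP y = y) : bridgeIndicator y = 0 :=
  if_pos h

/-- Without a neighbour, `x_i` is copied nowhere and injectivity can fail; isolated nodes are
therefore treated separately. -/
theorem copies_injective {i : V} (hi : ∃ j, G.Adj i j) :
    Function.Injective (copies (G := G) (n := n) i) := by
  obtain ⟨j₀, hj₀⟩ := hi
  intro v v' h
  have h' : ∀ j : G.neighborSet i, (v.1, v.2 j) = (v'.1, v'.2 j) := fun j =>
    congrArg (fun a : NodeSpace G n i => (a j).ofLp) h
  refine Prod.ext (congrArg (fun q : State n × State n => q.1) (h' ⟨j₀, hj₀⟩)) (funext fun j => congrArg (fun q : State n × State n => q.2) (h' j))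

variable [Fintype V] [DecidableRel G.Adj]

theorem inner_toEdgeSpace (a b : EdgeVar G n) : inner ℝ (toEdgeSpace a) (toEdgeSpace b) =
    ∑ d, (inner ℝ (a d).1 (b d).1 + inner ℝ (a d).2 (b d).2) := by
  rw [PiLp.inner_apply]
  rfl

theorem inner_swapMap_swapMap (a b : EdgeSpace G n) :
    inner ℝ (swapMap a) (swapMap b) = inner ℝ a b := by
  rw [PiLp.inner_apply, PiLp.inner_apply]
  refine Fintype.sum_equiv (Equiv.ofBijective _ SimpleGraph.Dart.symm_involutive.bijective) _ _
    fun d => ?_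
  rw [WithLp.prod_inner_apply, WithLp.prod_inner_apply, add_comm]
  rfl

theorem inner_swapMap_left (a b : EdgeSpace G n) :
    inner ℝ (swapMap a) b = inner ℝ a (swapMap b) := by
  rw [← inner_swapMap_swapMap a, swapMap_swapMap]

theorem inner_eq_zero_of_swapMap {a b : EdgeSpace G n} (ha : swapMap a = -a)
    (hb : swapMap b = b) : inner ℝ a b = 0 := by
  have h := inner_swapMap_swapMap a b
  rw [ha, hb, inner_neg_left] at h
  linarith

theorem norm_swapMap (a : EdgeSpace G n) : ‖swapMap a‖ = ‖a‖ := by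
  rw [norm_eq_sqrt_real_inner, norm_eq_sqrt_real_inner, inner_swapMap_swapMap]

theorem sum_dart {M : Type*} [AddCommMonoid M] (F : G.Dart → M) :
    ∑ d, F d = ∑ i, ∑ j : G.neighborSet i, F (G.dartOfNeighborSet i j) := by
  rw [← Fintype.sum_sigma']
  exact Fintype.sum_equiv
    { toFun := fun d => (⟨d.fst, d.snd, d.adj⟩ : Σ i, G.neighborSet i)
      invFun := fun q => G.dartOfNeighborSet q.1 q.2
      left_inv := fun _ => rfl
      right_inv := fun _ => rfl } _ _ fun _ => rfl

theorem inner_eq_sum_nodePart (a b : EdgeSpace G n) :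
    inner ℝ a b = ∑ i, inner ℝ (nodePart i a) (nodePart i b) := by
  rw [PiLp.inner_apply, sum_dart]
  simp only [PiLp.inner_apply]
  rfl

/-- `copies` repeats `x_i` once per neighbour, which produces the weight `|N_i|` on `‖x_i‖²`. -/
theorem updateObjective_eq (f : (i : V) → LocalVar G n i → EReal) (ρ : ℝ) (z : EdgeVar G n)
    (i : V) (v : LocalVar G n i) : updateObjective f ρ z i v =
      f i v + (proxTerm (copies i) ρ (nodePart i (swapMap (toEdgeSpace z))) v : EReal) := by
  unfold updateObjective proxTerm
  congr 2
  rw [PiLp.norm_sq_eq_of_L2 _ (copies i v),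
    PiLp.inner_apply (nodePart i (swapMap (toEdgeSpace z))) (copies i v)]
  have h1 : ∀ j : G.neighborSet i, inner ℝ (nodePart i (swapMap (toEdgeSpace z)) j) (copies i v j) =
      inner ℝ (z (inDart G i j)).2 v.1 + inner ℝ (z (inDart G i j)).1 (v.2 j) := fun j => rfl
  have h2 : ∀ j : G.neighborSet i, ‖copies i v j‖ ^ 2 = ‖v.1‖ ^ 2 + ‖v.2 j‖ ^ 2 := fun j =>
    WithLp.prod_norm_sq_eq_of_L2 _
  rw [Finset.sum_congr rfl fun j _ => h1 j, Finset.sum_congr rfl fun j _ => h2 j]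
  simp only [Finset.sum_add_distrib, Finset.sum_const, Finset.card_univ,
    SimpleGraph.card_neighborSet_eq_degree, sum_inner, nsmul_eq_mul]
  ring

theorem updateObjective_of_isolated (f : (i : V) → LocalVar G n i → EReal) (ρ : ℝ)
    (z : EdgeVar G n) {i : V} (hi : ∀ j, ¬ G.Adj i j) (v : LocalVar G n i) :
    updateObjective f ρ z i v = f i v := by
  have : IsEmpty (G.neighborSet i) := ⟨fun j => hi j j.2⟩
  have h : copies i v = 0 := Subsingleton.elim _ _
  simp [updateObjective_eq, proxTerm, h]

end Spaces

/-! ### Optimality conditions at a saddle point. -/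

section SaddlePoint

variable {V : Type*} [Fintype V] {G : SimpleGraph V} [DecidableRel G.Adj] {n : ℕ}
  {f : (i : V) → LocalVar G n i → EReal}

theorem lagrangian_eq (f : (i : V) → LocalVar G n i → EReal) (x : (i : V) → LocalVar G n i)
    (y w : EdgeVar G n) : lagrangian f x y w = (∑ i, f i (x i)) + bridgeIndicator y +
      ((-inner ℝ (toEdgeSpace w) (toEdgeSpace y - allCopies x) : ℝ) : EReal) := by
  unfold lagrangian
  congr 2
  rw [show toEdgeSpace y - allCopies x = toEdgeSpace (bridgeA x + y) by
    rw [sub_eq_add_neg, ← toEdgeSpace_bridgeA, add_comm]; rfl, inner_toEdgeSpace]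
  rfl

/-- The optimality conditions contained in a saddle point. -/
theorem IsSaddlePoint.optimality (hf : ∀ i, IsClosedProperConvex (f i))
    {x : (i : V) → LocalVar G n i} {y w : EdgeVar G n} (h : IsSaddlePoint f x y w) :
    swapMap (allCopies x) = allCopies x ∧ swapMap (toEdgeSpace w) = -toEdgeSpace w ∧
      ∀ i, HasSubgradient (f i) (copies i) (x i) (-nodePart i (toEdgeSpace w)) := by
  classical
  have hbot : ∀ x' : (i : V) → LocalVar G n i, ∀ i, f i (x' i) ≠ ⊥ := fun x' i =>
    (hf i).ne_bot _
  obtain ⟨x₁, hx₁⟩ : ∃ x₁ : (i : V) → LocalVar G n i, ∀ i, f i (x₁ i) ≠ ⊤ :=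
    ⟨_, fun i => (hf i).exists_ne_top.choose_spec⟩
  have hfin : (∑ i, f i (x i)) + bridgeIndicator y ≠ ⊤ := by
    intro htop
    have h1 := h.2 x₁ 0
    rw [lagrangian_eq, lagrangian_eq, htop, EReal.top_add_coe, top_le_iff,
      bridgeIndicator_of_eq (by rfl), add_zero] at h1
    obtain ⟨b, hb⟩ : ∃ b : ℝ, (b : EReal) = ∑ i, f i (x₁ i) :=
      ⟨_, EReal.coe_toReal (EReal_sum_ne_top (hbot x₁) hx₁) (EReal_sum_ne_bot (hbot x₁))⟩
    rw [← hb, ← EReal.coe_add] at h1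
    exact EReal.coe_ne_top _ h1
  have hy : swapP y = y := by
    by_contra hy
    apply hfin
    rw [bridgeIndicator, if_neg hy]
    exact EReal.add_top_of_ne_bot (EReal_sum_ne_bot (hbot x))
  have hx : ∀ i, f i (x i) ≠ ⊤ := by
    rw [bridgeIndicator_of_eq hy, add_zero] at hfin
    exact EReal_ne_top_of_sum_ne_top (hbot x) hfin
  set W := toEdgeSpace w with hW
  set Y := toEdgeSpace y with hY
  have hYs : swapMap Y = Y := by rw [hY, swapMap_toEdgeSpace, hy]
  choose a ha using fun i => (⟨_, EReal.coe_toReal (hx i) (hbot x i)⟩ :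
    ∃ b : ℝ, (b : EReal) = f i (x i))
  have hL : ∀ y' w', swapP y' = y' → lagrangian f x y' w' =
      ((∑ i, a i - inner ℝ (toEdgeSpace w') (toEdgeSpace y' - allCopies x) : ℝ) : EReal) := by
    intro y' w' hy'
    rw [lagrangian_eq, bridgeIndicator_of_eq hy', add_zero, sub_eq_add_neg (∑ i, a i),
      EReal.coe_add, EReal_coe_sum, Finset.sum_congr rfl fun i _ => ha i]
  -- Shifting the multiplier against the constraint residual would raise the Lagrangian by its
  -- squared norm.
  have hcons : Y - allCopies x = 0 := by
    have h1 := h.1 (ofEdgeSpace (W - (Y - allCopies x)))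
    rw [hL _ _ hy, hL _ _ hy, EReal.coe_le_coe_iff, toEdgeSpace_ofEdgeSpace, inner_sub_left] at h1
    have h2 := real_inner_self_nonneg (x := Y - allCopies x)
    exact inner_self_eq_zero (𝕜 := ℝ).1 (le_antisymm (by linarith) h2)
  have hYx : Y = allCopies x := sub_eq_zero.1 hcons
  refine ⟨by rw [← hYx, hYs], ?_, fun i => ⟨hx i, fun v => ?_⟩⟩
  · have hsw : swapMap (Y + (W + swapMap W)) = Y + (W + swapMap W) := by
      rw [map_add, map_add, swapMap_swapMap, hYs, add_comm (swapMap W)]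
    have h1 := h.2 x (ofEdgeSpace (Y + (W + swapMap W)))
    rw [hL _ _ hy, hL _ _ (congrArg ofEdgeSpace hsw), EReal.coe_le_coe_iff,
      toEdgeSpace_ofEdgeSpace, hcons, ← hYx, add_sub_cancel_left, inner_zero_right] at h1
    have h2 : inner ℝ (W + swapMap W) (W + swapMap W) = 2 * inner ℝ W (W + swapMap W) := by
      rw [inner_add_left, inner_swapMap_left, map_add, swapMap_swapMap, add_comm (swapMap W)]
      ring
    have h3 := real_inner_self_nonneg (x := W + swapMap W)
    have h4 : W + swapMap W = 0 :=
      inner_self_eq_zero (𝕜 := ℝ).1 (le_antisymm (by rw [h2]; linarith) h3)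
    exact (neg_eq_of_add_eq_zero_right h4).symm
  · by_cases hv : f i v = ⊤
    · rw [hv]
      exact le_top
    obtain ⟨b, hb⟩ : ∃ b : ℝ, (b : EReal) = f i v := ⟨_, EReal.coe_toReal hv ((hf i).ne_bot v)⟩
    -- Perturbing node `i` alone isolates its own subgradient inequality.
    have h1 := h.2 (Function.update x i v) y
    have hsum : ∑ j, f j (Function.update x i v j) =
        ((∑ j, Function.update a i b j : ℝ) : EReal) := by
      rw [EReal_coe_sum]
      refine Finset.sum_congr rfl fun j _ => ?_
      rcases eq_or_ne j i with rfl | hj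
      · simp [hb]
      · simp [hj, ha]
    rw [hL _ _ hy, lagrangian_eq, bridgeIndicator_of_eq hy, add_zero, hsum, ← EReal.coe_add,
      EReal.coe_le_coe_iff, hcons, inner_zero_right, ← hY, hYx, ← map_sub,
      inner_eq_sum_nodePart] at h1
    have h2 : ∑ j, Function.update a i b j = ∑ j, a j + (b - a i) := by
      rw [← sub_eq_iff_eq_add', ← Finset.sum_sub_distrib, Finset.sum_eq_single i]
      · simp
      · intro j _ hj
        simp [hj]
      · simp
    have h3 : ∑ j, inner ℝ (nodePart j (toEdgeSpace w))
        (nodePart j (allCopies (x - Function.update x i v))) =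
        inner ℝ (nodePart i W) (copies i (x i - v)) := by
      rw [Finset.sum_eq_single i]
      · simp [hW]
      · intro j _ hj
        simp [hj]
      · simp
    rw [h2, h3] at h1
    rw [← ha, ← hb, inner_neg_left, ← neg_sub, map_neg, inner_neg_right]
    norm_cast
    linarith

end SaddlePoint

/-! ### The ADMM operator: well-posedness, nonexpansiveness and fixed points. -/

section Convergence

variable {V : Type*} [Fintype V] {G : SimpleGraph V} [DecidableRel G.Adj] {n : ℕ}
  {f : (i : V) → LocalVar G n i → EReal} {ρ : ℝ}

theorem existsUnique_isLocalUpdate (hf : ∀ i, IsClosedProperConvex (f i))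
    (hsol : ∃ x y w, IsSaddlePoint f x y w)
    (hiso : ∀ i, (∀ j, ¬ G.Adj i j) → {v | ∀ u, f i v ≤ f i u}.Subsingleton)
    (hρ : 0 < ρ) (z : EdgeVar G n) (i : V) : ∃! v, IsLocalUpdate f ρ z i v := by
  obtain ⟨x, y, w, h⟩ := hsol
  have hsub := (h.optimality hf).2.2 i
  by_cases hi : ∃ j, G.Adj i j
  · simp only [IsLocalUpdate, updateObjective_eq]
    obtain ⟨v, hv⟩ := exists_isMin_of_hasSubgradient (hf i) (copies_injective hi) hρ
      (nodePart i (swapMap (toEdgeSpace z))) hsub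
    refine ⟨v, hv, fun v' hv' => copies_injective hi ?_⟩
    have h1 := mul_norm_sq_le_inner_of_isMin (hf i) hv' hv
    rw [sub_self, inner_zero_left] at h1
    have h2 : ‖copies i v' - copies i v‖ ^ 2 = 0 :=
      le_antisymm (by nlinarith) (sq_nonneg _)
    exact sub_eq_zero.1 (norm_eq_zero.1 (pow_eq_zero_iff two_ne_zero |>.1 h2))
  · have hi' : ∀ j, ¬ G.Adj i j := fun j hj => hi ⟨j, hj⟩
    have : IsEmpty (G.neighborSet i) := ⟨fun j => hi' j j.2⟩
    simp only [IsLocalUpdate, updateObjective_of_isolated f ρ z hi']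
    -- At an isolated node the subgradient term is zero, so the saddle point itself supplies a
    -- minimizer of `f i`.
    refine ⟨x i, fun u => ?_, fun v hv => hiso i hi' hv fun u => ?_⟩ <;>
    · have h1 := hsub.2 u
      rwa [show copies i (u - x i) = 0 from Subsingleton.elim _ _, inner_zero_right,
        EReal.coe_zero, add_zero] at h1

/-- Strong monotonicity of the map from auxiliary variables to local updates. -/
theorem mul_norm_sq_allCopies_le (hf : ∀ i, IsClosedProperConvex (f i)) {z z' : EdgeVar G n}
    {x x' : (i : V) → LocalVar G n i} (h : ∀ i, IsLocalUpdate f ρ z i (x i))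
    (h' : ∀ i, IsLocalUpdate f ρ z' i (x' i)) :
    ρ * ‖allCopies x - allCopies x'‖ ^ 2 ≤
      inner ℝ (swapMap (toEdgeSpace z - toEdgeSpace z')) (allCopies x - allCopies x') := by
  rw [← real_inner_self_eq_norm_sq, inner_eq_sum_nodePart, inner_eq_sum_nodePart, Finset.mul_sum]
  refine Finset.sum_le_sum fun i _ => ?_
  simp only [map_sub, nodePart_allCopies]
  rw [real_inner_self_eq_norm_sq]
  exact mul_norm_sq_le_inner_of_isMin (hf i)
    (by simpa only [IsLocalUpdate, updateObjective_eq] using h i)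
    (by simpa only [IsLocalUpdate, updateObjective_eq] using h' i)

/-- The difference of packets is `2ρ c - s`, and `‖2ρ c - s‖² = ‖s‖² - 4ρ (⟪s, c⟫ - ρ‖c‖²)`, where
the bracket is nonnegative and the swap preserves `‖s‖`. -/
theorem norm_packet_sub_le (hρ : 0 < ρ) (hf : ∀ i, IsClosedProperConvex (f i)) {z z' : EdgeVar G n}
    {x x' : (i : V) → LocalVar G n i} (h : ∀ i, IsLocalUpdate f ρ z i (x i))
    (h' : ∀ i, IsLocalUpdate f ρ z' i (x' i)) :
    ‖toEdgeSpace (packet ρ z x) - toEdgeSpace (packet ρ z' x')‖ ≤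
      ‖toEdgeSpace z - toEdgeSpace z'‖ := by
  have h1 := mul_norm_sq_allCopies_le hf h h'
  rw [← norm_swapMap (toEdgeSpace z - toEdgeSpace z')]
  set s := swapMap (toEdgeSpace z - toEdgeSpace z') with hs
  set c := allCopies x - allCopies x' with hc
  have e : toEdgeSpace (packet ρ z x) - toEdgeSpace (packet ρ z' x') = (2 * ρ) • c - s := by
    rw [toEdgeSpace_packet, toEdgeSpace_packet, hs, hc, map_sub]
    module
  rw [e]
  refine le_of_sq_le_sq ?_ (norm_nonneg _)
  rw [norm_sub_sq_real, norm_smul, real_inner_smul_left, mul_pow, Real.norm_eq_abs, sq_abs,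
    real_inner_comm]
  nlinarith

theorem norm_allCopies_sub_le (hρ : 0 < ρ) (hf : ∀ i, IsClosedProperConvex (f i))
    {z z' : EdgeVar G n} {x x' : (i : V) → LocalVar G n i} (h : ∀ i, IsLocalUpdate f ρ z i (x i))
    (h' : ∀ i, IsLocalUpdate f ρ z' i (x' i)) :
    ‖allCopies x - allCopies x'‖ ≤ ρ⁻¹ * ‖toEdgeSpace z - toEdgeSpace z'‖ := by
  have h1 := (mul_norm_sq_allCopies_le hf h h').trans (real_inner_le_norm _ _)
  rw [norm_swapMap] at h1
  rw [le_inv_mul_iff₀ hρ]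
  rcases (norm_nonneg (allCopies x - allCopies x')).eq_or_lt with h0 | h0
  · rw [← h0, mul_zero]
    exact norm_nonneg _
  · refine le_of_mul_le_mul_right ?_ h0
    linarith

/-- For `z = ρ C x + w` the symmetry of `C x` and antisymmetry of `w` give `P z - ρ C x = -w`, the
subgradient supplied by the saddle point. -/
theorem IsSaddlePoint.exists_packet_eq (hf : ∀ i, IsClosedProperConvex (f i)) (hρ : 0 < ρ)
    {x : (i : V) → LocalVar G n i} {y w : EdgeVar G n} (h : IsSaddlePoint f x y w) :
    ∃ z : EdgeVar G n, (∀ i, IsLocalUpdate f ρ z i (x i)) ∧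
      toEdgeSpace (packet ρ z x) = toEdgeSpace z := by
  obtain ⟨hx, hw, hsub⟩ := h.optimality hf
  refine ⟨ofEdgeSpace (ρ • allCopies x + toEdgeSpace w), fun i u => ?_, ?_⟩
  · rw [updateObjective_eq, updateObjective_eq]
    refine HasSubgradient.isMin (hf i).ne_bot hρ.le ?_ u
    convert hsub i using 1
    rw [toEdgeSpace_ofEdgeSpace, map_add, map_smul, hx, hw, map_add, map_smul, nodePart_allCopies,
      map_neg]
    abel
  · rw [toEdgeSpace_packet, toEdgeSpace_ofEdgeSpace, map_add, map_smul, hx, hw]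
    module

theorem isOptimal_of_packet_eq (hf : ∀ i, IsClosedProperConvex (f i)) (hρ : 0 < ρ)
    {z : EdgeVar G n} {x : (i : V) → LocalVar G n i} (h : ∀ i, IsLocalUpdate f ρ z i (x i))
    (hz : toEdgeSpace (packet ρ z x) = toEdgeSpace z) :
    IsOptimal f (fun i => (x i).1) ∧ ∀ i, ∀ j : G.neighborSet i, (x i).2 j = (x j).1 := by
  set Z := toEdgeSpace z with hZ
  rw [toEdgeSpace_packet, ← hZ] at hz
  have hxz : (2 * ρ) • allCopies x = Z + swapMap Z := by
    rw [← sub_eq_iff_eq_add, ← neg_add_eq_sub]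
    exact hz
  have hxs : swapMap (allCopies x) = allCopies x := by
    have h1 : (2 * ρ) • swapMap (allCopies x) = (2 * ρ) • allCopies x := by
      rw [← map_smul, hxz, map_add, swapMap_swapMap, add_comm]
    exact smul_right_injective _ (by positivity : 2 * ρ ≠ 0) h1
  have hcons : ∀ i, ∀ j : G.neighborSet i, (x i).2 j = (x j).1 := fun i j =>
    (congrArg (fun a : EdgeSpace G n => (a (G.dartOfNeighborSet i j)).ofLp.2) hxs).symm
  have hsub : ∀ i, HasSubgradient (f i) (copies i) (x i)
      (nodePart i (swapMap Z - ρ • allCopies x)) := fun i => by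
    have := hasSubgradient_of_isMin (hf i) (B := copies i) (ρ := ρ)
      (u := nodePart i (swapMap Z)) (v := x i) (by
        simpa only [IsLocalUpdate, updateObjective_eq] using h i)
    simpa only [map_sub, map_smul, nodePart_allCopies] using this
  have hxi : ∀ i, x i = ((x i).1, fun j : G.neighborSet i => (x j).1) := fun i =>
    Prod.ext rfl (funext fun j => hcons i j)
  have hcost : totalCost f (fun i => (x i).1) = ∑ i, f i (x i) :=
    Finset.sum_congr rfl fun i _ => by rw [← hxi i]
  refine ⟨⟨?_, fun x' => ?_⟩, hcons⟩
  · rw [hcost]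
    exact EReal_sum_ne_top (fun i => (hf i).ne_bot _) fun i => (hsub i).1
  · let v : (i : V) → LocalVar G n i := fun i => (x' i, fun j => x' j)
    have hvs : swapMap (allCopies v) = allCopies v := rfl
    have hsum : ∑ i, (f i (x i) + ((inner ℝ (nodePart i (swapMap Z - ρ • allCopies x))
        (copies i (v i - x i)) : ℝ) : EReal)) ≤ ∑ i, f i (v i) :=
      Finset.sum_le_sum fun i _ => (hsub i).2 (v i)
    rw [Finset.sum_add_distrib, ← EReal_coe_sum] at hsum
    have hzero : ∑ i, inner ℝ (nodePart i (swapMap Z - ρ • allCopies x)) (copies i (v i - x i)) =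
        0 := by
      -- The subgradients are antisymmetric and the difference of two consistent states is
      -- symmetric, so the linear terms cancel in the sum over nodes.
      have h1 : swapMap (swapMap Z - ρ • allCopies x) = -(swapMap Z - ρ • allCopies x) := by
        rw [map_sub, swapMap_swapMap, map_smul, hxs, eq_neg_iff_add_eq_zero]
        have : Z + swapMap Z - (2 * ρ) • allCopies x = 0 := sub_eq_zero.2 hxz.symm
        rw [← this]
        module
      have h2 : swapMap (allCopies (v - x)) = allCopies (v - x) := by
        rw [map_sub, map_sub, hxs, hvs]
      rw [← inner_eq_zero_of_swapMap h1 h2, inner_eq_sum_nodePart]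
      exact Finset.sum_congr rfl fun i _ => by rw [nodePart_allCopies, Pi.sub_apply]
    rw [hzero, EReal.coe_zero, add_zero] at hsum
    rw [hcost]
    exact hsum

theorem tendsto_localUpdate (hf : ∀ i, IsClosedProperConvex (f i))
    (hiso : ∀ i, (∀ j, ¬ G.Adj i j) → {v | ∀ u, f i v ≤ f i u}.Subsingleton) (hρ : 0 < ρ)
    {z : ℕ → EdgeVar G n} {x : ℕ → (i : V) → LocalVar G n i} {z' : EdgeVar G n}
    {x' : (i : V) → LocalVar G n i} (h : ∀ k i, IsLocalUpdate f ρ (z k) i (x k i))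
    (h' : ∀ i, IsLocalUpdate f ρ z' i (x' i))
    (hz : Tendsto (fun k => toEdgeSpace (z k)) atTop (𝓝 (toEdgeSpace z'))) (i : V) :
    Tendsto (fun k => (x k i).1) atTop (𝓝 (x' i).1) ∧
      ∀ j : G.neighborSet i, Tendsto (fun k => (x k i).2 j) atTop (𝓝 ((x' i).2 j)) := by
  have hlim : Tendsto (fun k => allCopies (x k)) atTop (𝓝 (allCopies x')) := by
    rw [tendsto_iff_norm_sub_tendsto_zero] at hz ⊢
    have h1 := hz.const_mul ρ⁻¹
    rw [mul_zero] at h1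
    exact squeeze_zero (fun _ => norm_nonneg _)
      (fun k => norm_allCopies_sub_le hρ hf (h k) h') h1
  have hd : ∀ j : G.neighborSet i, Tendsto (fun k => (x k i).1) atTop (𝓝 (x' i).1) ∧
      Tendsto (fun k => (x k i).2 j) atTop (𝓝 ((x' i).2 j)) := fun j => by
    have h1 : Continuous fun a : EdgeSpace G n => (a (G.dartOfNeighborSet i j)).ofLp.1 := by
      fun_prop
    have h2 : Continuous fun a : EdgeSpace G n => (a (G.dartOfNeighborSet i j)).ofLp.2 := by
      fun_prop
    exact ⟨(h1.tendsto _).comp hlim, (h2.tendsto _).comp hlim⟩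
  refine ⟨?_, fun j => (hd j).2⟩
  by_cases hi : ∃ j, G.Adj i j
  · obtain ⟨j, hj⟩ := hi
    exact (hd ⟨j, hj⟩).1
  · have hi' : ∀ j, ¬ G.Adj i j := fun j hj => hi ⟨j, hj⟩
    have hmin : ∀ {z : EdgeVar G n} {v : LocalVar G n i}, IsLocalUpdate f ρ z i v →
        v ∈ {v | ∀ u, f i v ≤ f i u} := fun hv u => by
      simpa only [updateObjective_of_isolated f ρ _ hi'] using hv u
    have hconst : ∀ k, x k i = x' i := fun k => hiso i hi' (hmin (h k i)) (hmin (h' i))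
    simp only [hconst]
    exact tendsto_const_nhds

end Convergence

end PartitionADMM

/-! ### The main theorem. -/

open PartitionADMM in
theorem proposition3 {V : Type*} [Fintype V] (G : SimpleGraph V) [DecidableRel G.Adj] (n : ℕ)
    -- closed proper convex local costs, with a primal-dual solution
    (f : (i : V) → LocalVar G n i → EReal)
    (hf : ∀ i, IsClosedProperConvex (f i))
    (hsol : ∃ x y w, IsSaddlePoint f x y w)
    -- a node without neighbours has at most one minimizer of its own cost
    (hiso : ∀ i, (∀ j, ¬ G.Adj i j) → {v | ∀ u, f i v ≤ f i u}.Subsingleton)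
    (α ρ p : ℝ) (hα0 : 0 < α) (hα1 : α < 1) (hρ : 0 < ρ) (hp0 : 0 ≤ p) (hp1 : p < 1)
    -- independent packet losses with probability p
    {Ω : Type*} [MeasurableSpace Ω] (μ : Measure Ω) [IsProbabilityMeasure μ]
    (L : ℕ → G.Dart → Ω → Bool)
    (hLmeas : ∀ k d, Measurable (L k d))
    (hLindep : iIndepFun (fun kd : ℕ × G.Dart => L kd.1 kd.2) μ)
    (hLprob : ∀ k d, μ {ω | L k d ω = true} = ENNReal.ofReal p) :
    -- every local update is well defined
    (∀ (z : EdgeVar G n) (i : V), ∃! v, IsLocalUpdate f ρ z i v) ∧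
    -- almost sure convergence from any initial condition
    ∀ (z₀ : EdgeVar G n) (x : Ω → ℕ → (i : V) → LocalVar G n i) (z : Ω → ℕ → EdgeVar G n),
      (∀ ω, IsTrajectory f α ρ (fun k d => L k d ω) z₀ (x ω) (z ω)) →
      ∀ᵐ ω ∂μ, ∃ xs : V → State n, IsOptimal f xs ∧
        ∀ i, Tendsto (fun k => (x ω k i).1) atTop (𝓝 (xs i)) ∧
          ∀ j : G.neighborSet i, Tendsto (fun k => (x ω k i).2 j) atTop (𝓝 (xs j)) := by
  have hex : ∀ (z : EdgeVar G n) (i : V), ∃! v, IsLocalUpdate f ρ z i v := fun z i =>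
    existsUnique_isLocalUpdate hf hsol hiso hρ z i
  refine ⟨hex, fun z₀ x z htraj => ?_⟩
  choose X hX hXu using hex
  set T : EdgeSpace G n → EdgeSpace G n := fun a =>
    toEdgeSpace (packet ρ (ofEdgeSpace a) (X (ofEdgeSpace a))) with hT
  have hTle : ∀ a b, ‖T a - T b‖ ≤ ‖a - b‖ := fun a b =>
    norm_packet_sub_le hρ hf (hX (ofEdgeSpace a)) (hX (ofEdgeSpace b))
  have hfix : ∃ a, T a = a := by
    obtain ⟨xs, y, w, h⟩ := hsol
    obtain ⟨zs, hzs, hp⟩ := h.exists_packet_eq hf hρ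
    have : xs = X zs := funext fun i => hXu zs i _ (hzs i)
    exact ⟨toEdgeSpace zs, by simpa only [hT, ofEdgeSpace_toEdgeSpace, ← this] using hp⟩
  -- Uniqueness of the minimizers makes every trajectory a deterministic function of the losses, so
  -- its measurability need not be assumed.
  have hxX : ∀ ω k, x ω k = X (z ω k) := fun ω k =>
    funext fun i => hXu _ i _ ((htraj ω).local_update k i)
  have hiter : ∀ ω, IsLossyIteration T α (fun k d => L k d ω) (fun k => toEdgeSpace (z ω k)) := by
    intro ω k d
    rw [toEdgeSpace_apply, (htraj ω).edge_update k d, hxX]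
    split_ifs <;> rfl
  filter_upwards [ae_tendsto_fixedPoint_of_lossyIteration hTle hfix hα0 hα1 hp0 hp1 hLmeas hLindep
    hLprob (z₀ := toEdgeSpace z₀) (z := fun ω k => toEdgeSpace (z ω k))
    (fun ω => by rw [(htraj ω).init]) hiter] with ω ⟨a, ha, hlim⟩
  obtain ⟨hopt, hcons⟩ := isOptimal_of_packet_eq hf hρ (hX (ofEdgeSpace a)) ha
  refine ⟨_, hopt, fun i => ?_⟩
  obtain ⟨h1, h2⟩ := tendsto_localUpdate hf hiso hρ (htraj ω).local_update (hX (ofEdgeSpace a))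
    hlim i
  exact ⟨h1, fun j => hcons i j ▸ h2 j⟩
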